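/- Let $\mathcal V=(V,\otimes,k)$ be a (commutative, unital) quantale: a complete lattice $V$ with a commutative monoid structure $(\otimes,k)$ such that $\otimes$ distributes over arbitrary suprema. A $\mathcal V$-relation $r\colon X\nrightarrow Y$ is a map $X\times Y\to V$; composition is $(s\cdot r)(x,z)=\bigvee_y r(x,y)\otimes s(y,z)$, and $\mathcal V$-relations are ordered pointwise. Let $(U,e,m)$ be the ultrafilter monad on sets; write $\dot x=e_X(x)$. A *strict ultrafilter theory* $\mathcal U$ consists of $\mathcal V$ together with a map $\xi\colon UV\to V$ such that (i) $\xi$ is an Eilenberg–Moore algebra structure, i.e. $\xi\cdot e_V=1_V$ and $\xi\cdot U\xi=\xi\cdot m_V$; (ii) $\xi(U\pi_1(\mathfrak w))\otimes\xi(U\pi_2(\mathfrak w))=\xi(U{\otimes}(\mathfrak w))$ for all $\mathfrak w\in U(V\times V)$; (iii) the maps $V^X\to V^{UX}$, $\varphi\mapsto\xi\cdot U\varphi$, are natural in $X$ with respect to the $\mathcal V$-powerset functor, which sends $f\colon X\to Y$ to $V^X\to V^Y$, $\varphi\mapsto\big(y\mapsto\bigvee_{f(x)=y}\varphi(x)\big)$.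 For $r\colon X\nrightarrow Y$ put $U_\xi r(\mathfrak x,\mathfrak y)=\bigvee\{\xi(Ur(\mathfrak w))\mid \mathfrak w\in U(X\times Y),\,U\pi_X(\mathfrak w)=\mathfrak x,\,U\pi_Y(\mathfrak w)=\mathfrak y\}$. A *$\mathcal V$-category* is a set $X$ with $a\colon X\nrightarrow X$ such that $k\le a(x,x)$ and $a(x,y)\otimes a(y,z)\le a(x,z)$; a *$\mathcal V$-functor* $f\colon(X,a)\to(Y,b)$ is a map with $a(x,x')\le b(f(x),f(x'))$. A *$\mathcal V$-distributor* $\varphi\colon(X,a)\to(Y,b)$ is a $\mathcal V$-relation with $\varphi\cdot a\le\varphi$ and $b\cdot\varphi\le\varphi$; distributors $\varphi\colon (Y,b)\to (X,a)$ and $\psi\colon (X,a)\to (Y,b)$ are adjoint, $\varphi\dashv\psi$, if $b\le\psi\cdot\varphi$ and $\varphi\cdot\psi\le a$. The $\mathcal V$-category $(X,a)$ is *Cauchy complete* if for all $\mathcal V$-categories $(Y,b)$ and all such $\varphi\dashv\psi$ there is a $\mathcal V$-functor $f\colon Y\to X$ with $\varphi(y,x)=a(f(y),x)$ and $\psi(x,y)=a(x,f(y))$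 for all $x,y$. A *$\mathcal U$-category* is a set $X$ with $a\colon UX\nrightarrow X$ such that $k\le a(\dot x,x)$ and $U_\xi a(\mathfrak X,\mathfrak x)\otimes a(\mathfrak x,x)\le a(m_X(\mathfrak X),x)$ for all $\mathfrak X\in UUX$, $\mathfrak x\in UX$, $x\in X$; a *$\mathcal U$-functor* $f\colon(X,a)\to(Y,b)$ is a map with $a(\mathfrak x,x)\le b(Uf(\mathfrak x),f(x))$. For $\varphi\colon UX\nrightarrow Y$ and $\psi\colon UY\nrightarrow Z$ put $\psi\circ\varphi=\psi\cdot U_\xi\varphi\cdot m_X^\circ\colon UX\nrightarrow Z$, where $m_X^\circ\colon UX\nrightarrow UUX$ has value $k$ at $(m_X(\mathfrak X),\mathfrak X)$ and $\bot$ elsewhere. A *$\mathcal U$-distributor* from $(X,a)$ to $(Y,b)$ is some $\varphi\colon UX\nrightarrow Y$ with $\varphi\circ a\le\varphi$ and $b\circ\varphi\le\varphi$. For $\mathcal U$-distributors $\varphi$ from $(X,a)$ to $(Y,b)$ and $\psi$ from $(Y,b)$ to $(X,a)$, $\varphi\dashv\psi$ means that $\psi\circ\varphi$ and $\varphi\circ\psi$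 are $\mathcal U$-distributors, $a\le\psi\circ\varphi$ and $\varphi\circ\psi\le b$. Let $G$ be the one-point $\mathcal U$-category with constant structure $k$. A $\mathcal U$-category $(X,a)$ is *Cauchy complete* if every adjunction $\varphi\dashv\psi$ of $\mathcal U$-distributors, with $\varphi$ from $G$ to $X$ and $\psi$ from $X$ to $G$, is of the form $\varphi=a(\dot x,-)$, $\psi=a(-,x)$ for some $x\in X$. **Theorem.** Let $\mathcal U$ be a strict ultrafilter theory. Then the forgetful functor $(-)_0\colon\mathcal U\text{-}\mathbf{Cat}\to\mathcal V\text{-}\mathbf{Cat}$, which sends $(X,a)$ to $(X,a_0)$ with $a_0(x,y)=a(\dot x,y)$ and leaves maps unchanged, sends Cauchy complete $\mathcal U$-categories to Cauchy complete $\mathcal V$-categories. -/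

import Mathlib

/-!
Conventions.  A quantale is a complete lattice `V` with a commutative monoid structure whose
multiplication `*` (the tensor product, with neutral element `1`, also written `k`) distributes over
arbitrary suprema; this is Mathlib's `IsQuantale` for a `CommMonoid` and a `CompleteLattice`.
Sets live in the same universe as the quantale.
A `V`-relation from `X` to `Y` is a map `X → Y → V`, ordered pointwise.
-/

universe u

namespace UltraTheory

open CategoryTheory

/-- The multiplication `m_X : UUX → UX` of the ultrafilter monad:
`A ∈ m_X 𝔛` iff `{𝔵 | A ∈ 𝔵} ∈ 𝔛`. -/
def mul {X : Type u} (F : Ultrafilter (Ultrafilter X)) : Ultrafilter X :=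
  Ultrafilter.bind F id

theorem mem_mul {X : Type u} (F : Ultrafilter (Ultrafilter X)) (A : Set X) :
    A ∈ mul F ↔ {x : Ultrafilter X | A ∈ x} ∈ F :=
  Iff.rfl

/-- The action of the `V`-powerset functor on a map `f : X → Y`:
it sends `φ : X → V` to `y ↦ ⋁ {φ x | f x = y}`. -/
def powersetMap {V : Type u} [CompleteLattice V] {X Y : Type u} (f : X → Y) (φ : X → V) : Y → V :=
  fun y => ⨆ (x : X) (_ : f x = y), φ x

/-- An ultrafilter theory based on the quantale `V`: a map `ξ : UV → V` that is an Eilenberg--Moore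
algebra structure for the ultrafilter monad, for which the tensor product is laxly continuous, and
which is compatible with suprema: the maps `V^X → V^(UX)`, `φ ↦ ξ ∘ Uφ`, are natural in `X` with
respect to the `V`-powerset functor. -/
structure UltrafilterTheory (V : Type u) [CommMonoid V] [CompleteLattice V] [IsQuantale V] where
  ξ : Ultrafilter V → V
  ξ_unit : ∀ v : V, ξ (pure v) = v
  ξ_mul : ∀ F : Ultrafilter (Ultrafilter V), ξ (F.map ξ) = ξ (mul F)
  ξ_tensor : ∀ w : Ultrafilter (V × V),
    ξ (w.map Prod.fst) * ξ (w.map Prod.snd) ≤ ξ (w.map fun p => p.1 * p.2)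
  ξ_sup : ∀ {X Y : Type u} (f : X → Y) (φ : X → V) (y : Ultrafilter Y),
    ξ (y.map (powersetMap f φ)) =
      powersetMap (fun x : Ultrafilter X => x.map f) (fun x => ξ (x.map φ)) y

section

variable {V : Type u} [CommMonoid V] [CompleteLattice V] [IsQuantale V]

/-- A strict ultrafilter theory: the tensor product is continuous. -/
def UltrafilterTheory.IsStrict (T : UltrafilterTheory V) : Prop :=
  ∀ w : Ultrafilter (V × V),
    T.ξ (w.map Prod.fst) * T.ξ (w.map Prod.snd) = T.ξ (w.map fun p => p.1 * p.2)

/-- Composition of `V`-relations: `comp s r` is `s · r`, first `r` and then `s`. -/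
def comp {X Y Z : Type u} (s : Y → Z → V) (r : X → Y → V) : X → Z → V :=
  fun x z => ⨆ y : Y, r x y * s y z

variable (V) in
/-- A (small) `V`-category. -/
structure VCat where
  carrier : Type u
  hom : carrier → carrier → V
  hom_refl : ∀ x, 1 ≤ hom x x
  hom_trans : ∀ x y z, hom x y * hom y z ≤ hom x z

/-- `V`-functors. -/
def IsVFunctor (X Y : VCat V) (f : X.carrier → Y.carrier) : Prop :=
  ∀ x x', X.hom x x' ≤ Y.hom (f x) (f x')

instance : Category (VCat V) where
  Hom X Y := {f : X.carrier → Y.carrier // IsVFunctor X Y f}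
  id X := ⟨id, fun _ _ => le_rfl⟩
  comp f g := ⟨g.1 ∘ f.1, fun x x' => (f.2 x x').trans (g.2 _ _)⟩

/-- `V`-distributors from `X` to `Y`: `φ · a ≤ φ` and `b · φ ≤ φ`. -/
def IsVDist (X Y : VCat V) (φ : X.carrier → Y.carrier → V) : Prop :=
  comp φ X.hom ≤ φ ∧ comp Y.hom φ ≤ φ

/-- `φ ⊣ ψ` for `V`-distributors `φ` from `X` to `Y` and `ψ` from `Y` to `X`. -/
structure IsVAdj (X Y : VCat V) (φ : X.carrier → Y.carrier → V)
    (ψ : Y.carrier → X.carrier → V) : Prop where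
  left_dist : IsVDist X Y φ
  right_dist : IsVDist Y X ψ
  unit : X.hom ≤ comp ψ φ
  counit : comp φ ψ ≤ Y.hom

/-- `f_* = b · f`. -/
def vLower {X Y : VCat V} (f : X ⟶ Y) : X.carrier → Y.carrier → V :=
  fun x y => Y.hom (f.1 x) y

/-- `f^* = f° · b`. -/
def vUpper {X Y : VCat V} (f : X ⟶ Y) : Y.carrier → X.carrier → V :=
  fun y x => Y.hom y (f.1 x)

/-- A `V`-category `X` is Cauchy complete if every adjunction `φ ⊣ ψ` of `V`-distributors, with
`φ` from `Y` to `X`, is represented by a `V`-functor from `Y` to `X`. -/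
def VCat.CauchyComplete (X : VCat V) : Prop :=
  ∀ (Y : VCat V) (φ : Y.carrier → X.carrier → V) (ψ : X.carrier → Y.carrier → V),
    IsVAdj Y X φ ψ → ∃ f : Y ⟶ X, φ = vLower f ∧ ψ = vUpper f

/-- The lax extension `U_ξ` of the ultrafilter functor to `V`-relations. -/
def UltrafilterTheory.ext (T : UltrafilterTheory V) {X Y : Type u} (r : X → Y → V) :
    Ultrafilter X → Ultrafilter Y → V :=
  fun x y => ⨆ (w : Ultrafilter (X × Y)) (_ : w.map Prod.fst = x) (_ : w.map Prod.snd = y),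
    T.ξ (w.map fun p => r p.1 p.2)

/-- Op-lax naturality of the unit of the ultrafilter monad. -/
theorem UltrafilterTheory.le_ext_pure (T : UltrafilterTheory V) {X Y : Type u} (r : X → Y → V)
    (x : X) (y : Y) : r x y ≤ T.ext r (pure x) (pure y) := by
  refine le_iSup_of_le (pure (x, y)) (le_iSup_of_le ?_ (le_iSup_of_le ?_ ?_))
  · exact Ultrafilter.map_pure _ _
  · exact Ultrafilter.map_pure _ _
  · rw [Ultrafilter.map_pure, T.ξ_unit]

/-- A `T`-category for an ultrafilter theory `T`. -/
structure UCat (T : UltrafilterTheory V) where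
  carrier : Type u
  hom : Ultrafilter carrier → carrier → V
  hom_refl : ∀ x, 1 ≤ hom (pure x) x
  hom_trans : ∀ (F : Ultrafilter (Ultrafilter carrier)) (y : Ultrafilter carrier) (x : carrier),
    T.ext hom F y * hom y x ≤ hom (mul F) x

variable {T : UltrafilterTheory V}

/-- `T`-functors. -/
def IsUFunctor (X Y : UCat T) (f : X.carrier → Y.carrier) : Prop :=
  ∀ (y : Ultrafilter X.carrier) (x : X.carrier), X.hom y x ≤ Y.hom (y.map f) (f x)

instance : Category (UCat T) where
  Hom X Y := {f : X.carrier → Y.carrier // IsUFunctor X Y f}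
  id X := ⟨id, fun _ _ => by simp⟩
  comp f g := ⟨g.1 ∘ f.1, fun y x => by
    rw [← Ultrafilter.map_map]
    exact (f.2 y x).trans (g.2 _ _)⟩

variable (T) in
/-- The forgetful functor `(-)₀ : T-Cat ⥤ V-Cat`, sending `(X, a)` to `(X, a · e_X)` and leaving maps
unchanged. -/
def forget₀ : UCat T ⥤ VCat V where
  obj X :=
    { carrier := X.carrier
      hom := fun x y => X.hom (pure x) y
      hom_refl := X.hom_refl
      hom_trans := fun x y z =>
        (mul_le_mul' (T.le_ext_pure X.hom (pure x) y) le_rfl).trans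
          (X.hom_trans (pure (pure x)) (pure y) z) }
  map f := ⟨f.1, fun x x' => (f.2 (pure x) x').trans (by rw [Ultrafilter.map_pure])⟩

variable (T) in
/-- The free `T`-category `G = (1, k)` on one point. -/
def unitUCat : UCat T where
  carrier := PUnit
  hom := fun _ _ => 1
  hom_refl := fun _ => le_rfl
  hom_trans := fun F y x => by
    rw [mul_one]
    refine iSup_le fun w => iSup_le fun _ => iSup_le fun _ => ?_
    have h : (w.map fun _ => (1 : V)) = pure 1 :=
      Ultrafilter.coe_injective (by simp [Filter.map_const])
    rw [h, T.ξ_unit]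

variable (T) in
/-- Kleisli composition `ψ ∘ φ = ψ · U_ξ φ · m_X°` of `φ : UX → Y → V` and `ψ : UY → Z → V`. -/
def kleisli {X Y Z : Type u} (ψ : Ultrafilter Y → Z → V) (φ : Ultrafilter X → Y → V) :
    Ultrafilter X → Z → V :=
  fun x z => ⨆ (F : Ultrafilter (Ultrafilter X)) (_ : mul F = x), comp ψ (T.ext φ) F z

/-- `T`-distributors from `X` to `Y`: `φ ∘ a ≤ φ` and `b ∘ φ ≤ φ`. -/
def IsUDist (X Y : UCat T) (φ : Ultrafilter X.carrier → Y.carrier → V) : Prop :=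
  kleisli T φ X.hom ≤ φ ∧ kleisli T Y.hom φ ≤ φ

/-- `φ ⊣ ψ` for `T`-distributors `φ` from `X` to `Y` and `ψ` from `Y` to `X`. -/
structure IsUAdj (X Y : UCat T) (φ : Ultrafilter X.carrier → Y.carrier → V)
    (ψ : Ultrafilter Y.carrier → X.carrier → V) : Prop where
  left_dist : IsUDist X Y φ
  right_dist : IsUDist Y X ψ
  comp_dist : IsUDist X X (kleisli T ψ φ)
  comp_dist' : IsUDist Y Y (kleisli T φ ψ)
  unit : X.hom ≤ kleisli T ψ φ
  counit : kleisli T φ ψ ≤ Y.hom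

/-- `f_⊛ = b · Uf`, for a map `f` into the carrier of `Y = (Y, b)`. -/
def uLower {X : Type u} {Y : UCat T} (f : X → Y.carrier) : Ultrafilter X → Y.carrier → V :=
  fun x y => Y.hom (x.map f) y

/-- `f^⊛ = f° · b`, for a map `f` into the carrier of `Y = (Y, b)`. -/
def uUpper {X : Type u} {Y : UCat T} (f : X → Y.carrier) : Ultrafilter Y.carrier → X → V :=
  fun y x => Y.hom y (f x)

/-- A `T`-category `X` is Cauchy complete if every adjunction `φ ⊣ ψ` of `T`-distributors, with
`φ` from `G` to `X`, is of the form `x_⊛ ⊣ x^⊛` for a point `x` of `X`, viewed as a map from `G`. -/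
def UCat.CauchyComplete (X : UCat T) : Prop :=
  ∀ (φ : Ultrafilter (unitUCat T).carrier → X.carrier → V)
    (ψ : Ultrafilter X.carrier → (unitUCat T).carrier → V),
    IsUAdj (unitUCat T) X φ ψ →
      ∃ x : X.carrier, φ = uLower (fun _ => x) ∧ ψ = uUpper (fun _ => x)

end

end UltraTheory

namespace UltraTheory

/-! Fixing a point of the source reduces an adjunction of `V`-distributors to a pair `f ⊣ g` on the
underlying `V`-category of `X`. The left part `f` serves unchanged as a distributor from `G`; the
right part is extended to ultrafilters by `g̃ 𝔵 = ⨆ z, a 𝔵 z * g z`, which restricts to `g` on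
principal ultrafilters. Once `f ⊣ g̃` is an adjunction of `T`-distributors, Cauchy completeness of
`X` yields a point representing both `f` and `g`, and these points assemble into the required
functor.

The crux is `ξ_extendRight_le`, compatibility of `g̃` with `ξ` and `mul`. It rests on
`IsStrict.ξ_map_iSup_mul_le`, where strictness enters, and on `ξ_right_le`. Together with
`ξ_left_mul_hom_le` it gives the distributor laws. -/

theorem map_const_eq_pure {X Y : Type*} (u : Ultrafilter X) (y : Y) :
    u.map (fun _ => y) = pure y :=
  Ultrafilter.coe_injective (by simp [Filter.map_const])

theorem eq_pure_unit (u : Ultrafilter PUnit) : u = pure PUnit.unit :=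
  (Ultrafilter.map_id u).symm.trans (map_const_eq_pure u PUnit.unit)

theorem mul_pure_ultrafilter {X : Type u} (x : Ultrafilter X) : mul (pure x) = x :=
  Ultrafilter.ext fun _ => Iff.rfl

theorem mul_map_pure {X : Type u} (x : Ultrafilter X) : mul (x.map pure) = x :=
  Ultrafilter.ext fun _ => Iff.rfl

variable {V : Type u} [CommMonoid V] [CompleteLattice V] [IsQuantale V]

/-! ### Calculus of `ξ` and of the lax extension. -/

namespace UltrafilterTheory

variable (T : UltrafilterTheory V)

/-- Monotonicity is naturality along the codiagonal `X ⊕ X → X`: as `φ ≤ χ`, the copairing of `φ`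
and `χ` is pushed forward to `χ`, and the left copy of `x` lies in the fibre over `x`. -/
theorem ξ_map_mono {X : Type u} {φ χ : X → V} (h : φ ≤ χ) (x : Ultrafilter X) :
    T.ξ (x.map φ) ≤ T.ξ (x.map χ) := by
  have hχ : powersetMap (Sum.elim id id) (Sum.elim φ χ) = χ := by
    funext y
    refine le_antisymm (iSup₂_le ?_) (le_iSup₂_of_le (Sum.inr y) rfl le_rfl)
    rintro (z | z) rfl
    exacts [h z, le_rfl]
  have key := T.ξ_sup (Sum.elim id id) (Sum.elim φ χ) x
  rw [hχ] at key
  rw [key]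
  refine le_iSup₂_of_le (x.map Sum.inl) ?_ ?_
  · exact (Ultrafilter.map_map ..).trans (Ultrafilter.map_id x)
  · beta_reduce; rw [Ultrafilter.map_map]; rfl

theorem ξ_map_mul_le {X : Type u} (φ χ : X → V) (x : Ultrafilter X) :
    T.ξ (x.map φ) * T.ξ (x.map χ) ≤ T.ξ (x.map fun z => φ z * χ z) := by
  simpa only [Ultrafilter.map_map, Function.comp_def] using
    T.ξ_tensor (x.map fun z => (φ z, χ z))

variable {T} in
theorem IsStrict.ξ_map_mul (hT : T.IsStrict) {X : Type u} (φ χ : X → V) (x : Ultrafilter X) :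
    T.ξ (x.map fun z => φ z * χ z) = T.ξ (x.map φ) * T.ξ (x.map χ) := by
  simpa only [Ultrafilter.map_map, Function.comp_def] using
    (hT (x.map fun z => (φ z, χ z))).symm

theorem ξ_map_mul_const_le {X : Type u} (φ : X → V) (v : V) (x : Ultrafilter X) :
    T.ξ (x.map φ) * v ≤ T.ξ (x.map fun z => φ z * v) := by
  simpa only [map_const_eq_pure, T.ξ_unit] using T.ξ_map_mul_le φ (fun _ => v) x

theorem ξ_map_le_ext {X Y Z : Type u} (r : X → Y → V) (f : Z → X) (g : Z → Y)
    (z : Ultrafilter Z) :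
    T.ξ (z.map fun t => r (f t) (g t)) ≤ T.ext r (z.map f) (z.map g) := by
  refine le_iSup_of_le (z.map fun t => (f t, g t)) (le_iSup₂_of_le ?_ ?_ ?_)
  · rw [Ultrafilter.map_map]; rfl
  · rw [Ultrafilter.map_map]; rfl
  · rw [Ultrafilter.map_map]; rfl

theorem ext_fst {X Y : Type u} (r : X → V) (x : Ultrafilter X) (y : Ultrafilter Y) :
    T.ext (fun s (_ : Y) => r s) x y ≤ T.ξ (x.map r) := by
  refine iSup_le fun w => iSup₂_le fun hx _ => ?_
  rw [← hx, Ultrafilter.map_map]; rfl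

theorem ext_snd {X Y : Type u} (r : Y → V) (x : Ultrafilter X) (y : Ultrafilter Y) :
    T.ext (fun (_ : X) s => r s) x y ≤ T.ξ (y.map r) := by
  refine iSup_le fun w => iSup₂_le fun _ hy => ?_
  rw [← hy, Ultrafilter.map_map]; rfl

variable {T} in
theorem IsStrict.ext_mul_le (hT : T.IsStrict) {X Y : Type u} (r : X → V) (s : Y → V)
    (x : Ultrafilter X) (y : Ultrafilter Y) :
    T.ext (fun p q => r p * s q) x y ≤ T.ξ (x.map r) * T.ξ (y.map s) := by
  refine iSup_le fun w => iSup₂_le fun hx hy => ?_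
  rw [hT.ξ_map_mul (fun p : X × Y => r p.1) (fun p => s p.2) w, ← hx, ← hy, Ultrafilter.map_map,
    Ultrafilter.map_map]
  rfl

variable {T} in
/-- Under strictness `ξ ∘ U` preserves the composite of a `V`-relation with a `V`-valued map. -/
theorem IsStrict.ξ_map_iSup_mul_le (hT : T.IsStrict) {X Y : Type u} (r : X → Y → V) (g : Y → V)
    (x : Ultrafilter X) :
    T.ξ (x.map fun s => ⨆ t, r s t * g t) ≤
      ⨆ y : Ultrafilter Y, T.ext r x y * T.ξ (y.map g) := by
  -- The supremum over `t` is a pushforward along the first projection, so naturality moves it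
  -- outside `ξ`, over ultrafilters on `X × Y`; strictness then splits the product.
  have h : powersetMap (Prod.fst : X × Y → X) (fun p => r p.1 p.2 * g p.2) =
      fun s => ⨆ t, r s t * g t := by
    funext s
    refine le_antisymm (iSup₂_le ?_) (iSup_le fun t => le_iSup₂_of_le (s, t) rfl le_rfl)
    rintro ⟨p, q⟩ rfl
    exact le_iSup (fun t => r p t * g t) q
  rw [← h, T.ξ_sup]
  refine iSup₂_le fun w hw => ?_
  beta_reduce
  rw [hT.ξ_map_mul (fun p : X × Y => r p.1 p.2) (fun p => g p.2) w]
  refine le_iSup_of_le (w.map Prod.snd) (mul_le_mul' ?_ ?_)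
  · rw [← hw]
    exact T.ξ_map_le_ext r Prod.fst Prod.snd w
  · rw [Ultrafilter.map_map]; rfl

end UltrafilterTheory

variable {T : UltrafilterTheory V}

theorem ext_unitUCat_le_one (F : Ultrafilter (Ultrafilter PUnit.{u + 1}))
    (y : Ultrafilter PUnit.{u + 1}) : T.ext (unitUCat T).hom F y ≤ 1 :=
  (T.ext_fst (fun _ : Ultrafilter PUnit.{u + 1} => (1 : V)) F y).trans
    (by rw [map_const_eq_pure, T.ξ_unit])

theorem kleisli_le_iff {X Y Z : Type u} {ψ : Ultrafilter Y → Z → V} {φ : Ultrafilter X → Y → V}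
    {χ : Ultrafilter X → Z → V} :
    kleisli T ψ φ ≤ χ ↔ ∀ F y z, T.ext φ F y * ψ y z ≤ χ (mul F) z := by
  refine ⟨fun h F y z => le_trans ?_ (h (mul F) z), fun h x z => iSup₂_le ?_⟩
  · exact le_iSup₂_of_le F rfl (le_iSup (fun y => T.ext φ F y * ψ y z) y)
  · rintro F rfl
    exact iSup_le fun y => h F y z

/-- Every `V`-relation from `U1` to `1` is a distributor from `G` to `G`. -/
theorem isUDist_unitUCat (θ : Ultrafilter (unitUCat T).carrier → (unitUCat T).carrier → V) :
    IsUDist (unitUCat T) (unitUCat T) θ := by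
  obtain ⟨v, rfl⟩ : ∃ v, θ = fun _ _ => v :=
    ⟨θ (pure PUnit.unit) PUnit.unit, by funext x y; rw [eq_pure_unit x]; rfl⟩
  constructor <;> refine kleisli_le_iff.2 fun F y z => ?_
  · exact (mul_le_mul' (ext_unitUCat_le_one F y) le_rfl).trans (one_mul v).le
  · refine (mul_le_mul' (T.ext_fst (fun _ => v) F y) le_rfl).trans ?_
    rw [map_const_eq_pure, T.ξ_unit]
    exact (mul_one v).le

/-! ### Point adjunctions and their extension to ultrafilters. -/

namespace UCat

variable {X : UCat T}

theorem hom_mul_hom_pure_le (x : Ultrafilter X.carrier) (y z : X.carrier) :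
    X.hom x y * X.hom (pure y) z ≤ X.hom x z :=
  (mul_le_mul' (T.le_ext_pure X.hom x y) le_rfl).trans
    ((X.hom_trans _ _ _).trans_eq (by rw [mul_pure_ultrafilter]))

theorem ξ_hom_pure_mul_hom_le (z x : X.carrier) (y : Ultrafilter X.carrier) :
    T.ξ (y.map fun t => X.hom (pure z) t) * X.hom y x ≤ X.hom (pure z) x := by
  have h := T.ξ_map_le_ext X.hom (fun _ => pure z) id y
  rw [map_const_eq_pure, Ultrafilter.map_id] at h
  exact (mul_le_mul' h le_rfl).trans
    ((X.hom_trans _ _ _).trans_eq (by rw [mul_pure_ultrafilter]))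

theorem ξ_hom_pure_le (y : Ultrafilter X.carrier) (z : X.carrier) :
    T.ξ (y.map fun t => X.hom (pure t) z) ≤ X.hom y z := by
  have h := T.ξ_map_le_ext X.hom pure (fun _ => z) y
  -- Transitivity is applied to `y.map pure`, whose multiplication is `y`, with `pure z` as middle
  -- term.
  rw [map_const_eq_pure] at h
  calc T.ξ (y.map fun t => X.hom (pure t) z)
      ≤ T.ext X.hom (y.map pure) (pure z) * X.hom (pure z) z :=
        h.trans (le_mul_of_one_le_right' (X.hom_refl z))
    _ ≤ X.hom y z := (X.hom_trans _ _ _).trans_eq (by rw [mul_map_pure])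

variable (X) in
/-- An adjunction `f ⊣ g` of `V`-distributors between the one-point `V`-category `(1, k)` and the
underlying `V`-category of `X`. -/
structure IsPointAdj (f g : X.carrier → V) : Prop where
  left_hom : ∀ x y, f x * X.hom (pure x) y ≤ f y
  hom_right : ∀ x y, X.hom (pure x) y * g y ≤ g x
  unit : 1 ≤ ⨆ x, f x * g x
  counit : ∀ x y, g x * f y ≤ X.hom (pure x) y

variable (X) in
/-- The composite of `g` with the structure of `X`. -/
def extendRight (g : X.carrier → V) (x : Ultrafilter X.carrier) : V :=
  ⨆ z, X.hom x z * g z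

theorem ext_hom_mul_extendRight_le (g : X.carrier → V)
    (F : Ultrafilter (Ultrafilter X.carrier)) (y : Ultrafilter X.carrier) :
    T.ext X.hom F y * X.extendRight g y ≤ X.extendRight g (mul F) := by
  rw [extendRight, Quantale.mul_iSup_distrib]
  refine iSup_mono fun z => ?_
  rw [← mul_assoc]
  exact mul_le_mul' (X.hom_trans F y z) le_rfl

namespace IsPointAdj

variable {f g : X.carrier → V}

theorem le_iSup_mul (h : X.IsPointAdj f g) (v : V) : v ≤ ⨆ z, v * (f z * g z) := by
  rw [← Quantale.mul_iSup_distrib]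
  exact le_mul_of_one_le_right' h.unit

/-- The unit inserts a factor `f z * g z`; the counit uses `g z` to turn `f` under `ξ` into the
representable at `z`, where transitivity of `X` applies, and `f z` is absorbed at the end. Lax
continuity of the tensor suffices. -/
theorem ξ_left_mul_hom_le (h : X.IsPointAdj f g) (y : Ultrafilter X.carrier) (x : X.carrier) :
    T.ξ (y.map f) * X.hom y x ≤ f x := by
  refine (h.le_iSup_mul _).trans (iSup_le fun z => ?_)
  have hz : T.ξ (y.map f) * g z ≤ T.ξ (y.map fun t => X.hom (pure z) t) :=
    (T.ξ_map_mul_const_le f (g z) y).trans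
      (T.ξ_map_mono (fun t => (mul_comm _ _).trans_le (h.counit z t)) y)
  calc T.ξ (y.map f) * X.hom y x * (f z * g z)
      = f z * (T.ξ (y.map f) * g z * X.hom y x) := by ac_rfl
    _ ≤ f z * X.hom (pure z) x :=
        mul_le_mul' le_rfl ((mul_le_mul' hz le_rfl).trans (X.ξ_hom_pure_mul_hom_le z x y))
    _ ≤ f x := h.left_hom z x

theorem ξ_right_le (h : X.IsPointAdj f g) (y : Ultrafilter X.carrier) :
    T.ξ (y.map g) ≤ X.extendRight g y := by
  refine (h.le_iSup_mul _).trans (iSup_mono fun z => ?_)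
  rw [← mul_assoc]
  refine mul_le_mul' ((T.ξ_map_mul_const_le g (f z) y).trans ?_) le_rfl
  exact (T.ξ_map_mono (fun t => h.counit t z) y).trans (X.ξ_hom_pure_le y z)

theorem ξ_extendRight_le (hT : T.IsStrict) (h : X.IsPointAdj f g)
    (F : Ultrafilter (Ultrafilter X.carrier)) :
    T.ξ (F.map (X.extendRight g)) ≤ X.extendRight g (mul F) :=
  (hT.ξ_map_iSup_mul_le X.hom g F).trans (iSup_le fun y =>
    (mul_le_mul' le_rfl (h.ξ_right_le y)).trans (X.ext_hom_mul_extendRight_le g F y))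

theorem extendRight_pure (h : X.IsPointAdj f g) (x : X.carrier) :
    X.extendRight g (pure x) = g x :=
  le_antisymm (iSup_le (h.hom_right x))
    (le_iSup_of_le x (le_mul_of_one_le_left' (X.hom_refl x)))

theorem extendRight_mul_le (h : X.IsPointAdj f g) (y : Ultrafilter X.carrier) (x : X.carrier) :
    X.extendRight g y * f x ≤ X.hom y x := by
  rw [extendRight, Quantale.iSup_mul_distrib]
  refine iSup_le fun z => ?_
  rw [mul_assoc]
  exact (mul_le_mul' le_rfl (h.counit z x)).trans (X.hom_mul_hom_pure_le y z x)

/-- An exact formula, not just a bound, since it serves both the counit and the requirement that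
this composite be a distributor. -/
theorem kleisli_extendRight (hT : T.IsStrict) (h : X.IsPointAdj f g) :
    kleisli T (fun (_ : Ultrafilter PUnit.{u + 1}) x => f x)
      (fun y (_ : PUnit.{u + 1}) => X.extendRight g y) = fun y x => X.extendRight g y * f x := by
  refine le_antisymm (kleisli_le_iff.2 fun F y x => ?_) fun y x => ?_
  · exact mul_le_mul' ((T.ext_fst _ F y).trans (h.ξ_extendRight_le hT F)) le_rfl
  · refine le_iSup₂_of_le (pure y) (mul_pure_ultrafilter y)
      (le_iSup_of_le (pure PUnit.unit) (mul_le_mul' ?_ le_rfl))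
    exact T.le_ext_pure (fun y (_ : PUnit.{u + 1}) => X.extendRight g y) y PUnit.unit

/-- For a strict theory, an adjunction of `V`-distributors into the underlying `V`-category
extends to an adjunction of `T`-distributors. -/
theorem isUAdj (hT : T.IsStrict) (h : X.IsPointAdj f g) :
    IsUAdj (unitUCat T) X (fun _ x => f x) (fun y _ => X.extendRight g y) where
  left_dist := by
    constructor <;> refine kleisli_le_iff.2 fun F y x => ?_
    · exact (mul_le_mul' (ext_unitUCat_le_one F y) le_rfl).trans (one_mul _).le
    · exact (mul_le_mul' (T.ext_snd f F y) le_rfl).trans (h.ξ_left_mul_hom_le y x)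
  right_dist := by
    constructor <;> refine kleisli_le_iff.2 fun F y x => ?_
    · exact X.ext_hom_mul_extendRight_le g F y
    · exact (mul_le_mul' ((T.ext_fst _ F y).trans (h.ξ_extendRight_le hT F)) le_rfl).trans
        (mul_one _).le
  comp_dist := isUDist_unitUCat _
  comp_dist' := by
    have hk := h.kleisli_extendRight hT
    change IsUDist X X (kleisli T (fun (_ : Ultrafilter PUnit.{u + 1}) x => f x)
      (fun y (_ : PUnit.{u + 1}) => X.extendRight g y))
    rw [hk]
    constructor <;> refine kleisli_le_iff.2 fun F y x => ?_
    · rw [← mul_assoc]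
      exact mul_le_mul' (X.ext_hom_mul_extendRight_le g F y) le_rfl
    -- Strictness separates the two factors, so each can be treated by its own estimate.
    · refine (mul_le_mul' (hT.ext_mul_le (X.extendRight g) f F y) le_rfl).trans ?_
      rw [mul_assoc]
      exact mul_le_mul' (h.ξ_extendRight_le hT F) (h.ξ_left_mul_hom_le y x)
  unit := fun y _ => by
    refine h.unit.trans (iSup_le fun x => ?_)
    refine le_iSup₂_of_le (pure y) (mul_pure_ultrafilter y)
      (le_iSup_of_le (pure x) (mul_le_mul' ?_ (h.extendRight_pure x).ge))
    exact T.le_ext_pure (fun (_ : Ultrafilter PUnit.{u + 1}) x => f x) y x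
  counit := (h.kleisli_extendRight hT).trans_le h.extendRight_mul_le

theorem exists_point (hT : T.IsStrict) (hX : X.CauchyComplete) (h : X.IsPointAdj f g) :
    ∃ x : X.carrier, (∀ y, f y = X.hom (pure x) y) ∧ ∀ y, g y = X.hom (pure y) x := by
  obtain ⟨x, hf, hg⟩ := hX _ _ (h.isUAdj hT)
  refine ⟨x, fun y => ?_, fun y => ?_⟩
  · exact congrFun (congrFun hf (pure PUnit.unit)) y
  · rw [← h.extendRight_pure y]
    exact congrFun (congrFun hg (pure y)) PUnit.unit

end IsPointAdj

theorem isPointAdj_of_isVAdj {Y : VCat V} {φ : Y.carrier → X.carrier → V}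
    {ψ : X.carrier → Y.carrier → V} (h : IsVAdj Y ((forget₀ T).obj X) φ ψ) (y : Y.carrier) :
    X.IsPointAdj (φ y) (fun x => ψ x y) where
  left_hom x z := (le_iSup (fun x => φ y x * X.hom (pure x) z) x).trans (h.left_dist.2 y z)
  hom_right x z := (le_iSup (fun z => X.hom (pure x) z * ψ z y) z).trans (h.right_dist.1 x y)
  unit := (Y.hom_refl y).trans (h.unit y y)
  counit x z := (le_iSup (fun y => ψ x y * φ y z) y).trans (h.counit x z)

end UCat

end UltraTheory

theorem mainTheorem5 {V : Type u} [CommMonoid V] [CompleteLattice V] [IsQuantale V]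
    (T : UltraTheory.UltrafilterTheory V) (hT : T.IsStrict)
    (X : UltraTheory.UCat T) (hX : X.CauchyComplete) :
    ((UltraTheory.forget₀ T).obj X).CauchyComplete := by
  intro Y φ ψ h
  choose p hφ hψ using fun y => (UltraTheory.UCat.isPointAdj_of_isVAdj h y).exists_point hT hX
  -- Functoriality of the chosen points follows from the unit: each term of `ψ · φ` is a composite
  -- from `p y` to `p y'` through `x`.
  refine ⟨⟨p, fun y y' => (h.unit y y').trans (iSup_le fun x => ?_)⟩, ?_, ?_⟩
  · exact (mul_le_mul' (hφ y x).le (hψ y' x).le).trans (X.hom_mul_hom_pure_le _ _ _)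
  · funext y x; exact hφ y x
  · funext x y; exact hψ y x
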